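/- **Setting.** The infinite triangular grid is drawn so that one of its three families of lines is parallel to the $y$-axis. The six neighbours of a vertex are $v_1$ (below), $v_2^\ell, v_2^r$ (lower left, lower right), $v_3^\ell, v_3^r$ (upper left, upper right) and $v_4$ (above). A global state $s$ gives the locations of $n\ge 1$ anonymous robots, several of which may be at one vertex; the state space $S$ consists of the states whose visibility graph (the subgraph of the grid induced by the occupied vertices) is connected. A robot senses only which of its six neighbouring vertices are occupied; robots agree on up and down but not on left and right. GMRIT asks that all robots gather at one vertex and stay there forever. **Revised algorithm.** Robot $i$ moves to $v_1(i)$ if either $v_1(i)$ is occupied and none of $v_3^\ell(i),v_4(i),v_3^r(i)$ is, or exactly $v_2^\ell(i)$ and $v_2^r(i)$ are occupied among its six neighbouring vertices; it moves to $v_2^r(i)$ (resp. $v_2^\ell(i)$) if that is its only occupied neighbouring vertex; otherwise it does not move. It is *enabled* in $s$ if one of these conditions holds. **Asynchronous computations.** A computation is a sequence $s_0,s_1,\dots$ of global states. At each time $t$ an arbitrary set of robots evaluate their guards; such a robot $i$ does so on a snapshot of its surroundings in a state $s_\tau$, $\tau\le t$, where $\tau$ may depend on $i$ and $t$ and is arbitrary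 except that $i$ has not moved between times $\tau$ and $t$; it moves accordingly, giving $s_{t+1}[i]$. All other robots keep their locations. A *round* is a time interval in which every robot at least once evaluates its guards, and moves accordingly, on a snapshot taken in that interval. A computation is *fair* if every robot evaluates its guards infinitely often on arbitrarily recent snapshots (i.e. for each robot and each time $a$, some evaluation uses a snapshot taken at or after $a$). **The point $Q$.** $Q(s)$ is the intersection of the leftmost line parallel to the negative-slope grid lines through a robot of $s$ and the rightmost line parallel to the positive-slope grid lines through a robot of $s$. **Lattice-linearity.** Given strict total orders $\prec_i$ on the local states of each node $i$, write $s\prec s'$ if for all $i$, $s[i]=s'[i]$ or $s[i]\prec_i s'[i]$, with $s[i]\prec_i s'[i]$ for some $i$; write $s\preceq s'$ if $s=s'$ or $s\prec s'$. For a set $S_k$ of states and a predicate $\mathcal P$, node $i$ is *impedensable* in $s$ if $\neg\mathcal P(s)$ and $\neg\mathcal P(s')$ for all $s'\in S_k$ with $s\prec s'$ and $s'[i]=s[i]$. An algorithm is a *self-stabilizing lattice-linear algorithm* with predicate $\mathcal P$ for a problem with state space $S$ if on $S$ the problem is solved exactly where $\mathcal P$ holds, and $S$ is the disjoint union of a non-empty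 (possibly infinite) family of sets $S_k$, each with such an order, such that for each $k$: every asynchronous computation starting in $S_k$ stays in $S_k$ and is non-decreasing for $\preceq$; every $s\in S_k$ with $\neg\mathcal P(s)$ has an impedensable node; every enabled node in a state of $S_k$ is impedensable; and $S_k$ has a greatest element, at which $\mathcal P$ holds. **Theorem.** For every $n\ge1$: 1. The rule of the revised algorithm is invariant under exchanging left and right, and the revised algorithm is a self-stabilizing lattice-linear algorithm for GMRIT on $n$ robots under asynchrony, with the predicate "no robot is enabled" (in particular, the visibility graph stays connected). 2. It is silent self-stabilizing: every fair asynchronous computation starting in $S$ reaches a state in which all robots are at one vertex; and in any asynchronous computation starting in $S$, once such a state is reached no robot ever moves again. 3. For every asynchronous computation with $s_0\in S$, the point $Q=Q(s_0)$ exists and is a unique vertex of the grid; if the computation is fair, then from some time on all robots are at $Q$; and once $2n$ consecutive rounds starting at time $0$ have been completed, all robots are at $Q$ forever. -/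

import Mathlib

/-! ### Asynchronous distributed algorithms -/

namespace LatticeLinear

/-- A deterministic distributed algorithm for nodes `ι` with local states in `Λ`.  Given the global
state that node `i` believes to be in, it returns `none` if all guards of `i` are false, and
`some x` if a guard of `i` is true and the corresponding action gives `i` the local state `x`. -/
abbrev Algorithm (ι Λ : Type) := ι → (ι → Λ) → Option Λ

/-- Some guard of node `i` is true in the global state `s`. -/
def Enabled {ι Λ : Type} (A : Algorithm ι Λ) (i : ι) (s : ι → Λ) : Prop :=
  A i s ≠ none

/-- An asynchronous computation of `A`.  At time `t` an arbitrary set `active t` of nodes evaluate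
their guards.  Node `i ∈ active t` does so on a snapshot of the global state taken at some time
`look t i ≤ t`, which may be old; the only restriction is that `i` has not moved since it took that
snapshot (every node takes a new snapshot after each of its moves). -/
structure Computation {ι Λ : Type} (A : Algorithm ι Λ) where
  state : ℕ → ι → Λ
  active : ℕ → Set ι
  look : ℕ → ι → ℕ
  look_le : ∀ t, ∀ i ∈ active t, look t i ≤ t
  not_moved : ∀ t, ∀ i ∈ active t, ∀ r, look t i ≤ r → r ≤ t → state r i = state t i
  step_active : ∀ t, ∀ i ∈ active t,
    state (t + 1) i = (A i (state (look t i))).getD (state t i)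
  step_idle : ∀ t, ∀ i ∉ active t, state (t + 1) i = state t i

/-- The time interval from `a` to `b` contains a round: every node takes a snapshot, evaluates its
guards on it, and moves accordingly, at least once. -/
def Computation.IsRound {ι Λ : Type} {A : Algorithm ι Λ} (C : Computation A) (a b : ℕ) : Prop :=
  ∀ i, ∃ t, a ≤ t ∧ t < b ∧ i ∈ C.active t ∧ a ≤ C.look t i

/-- Every node takes snapshots, and evaluates its guards on them, again and again. -/
def Computation.Fair {ι Λ : Type} {A : Algorithm ι Λ} (C : Computation A) : Prop :=
  ∀ i, ∀ a, ∃ t, i ∈ C.active t ∧ a ≤ C.look t i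

/-- `A` is silent self-stabilizing on the state space `S` with respect to the set `So` of optimal
states: every fair computation from an arbitrary state of `S` reaches `So`; and in every
computation, once a state of `So` is reached, the system stays in `So`, and no node moves. -/
def IsSilentSelfStabilizing {ι Λ : Type} (A : Algorithm ι Λ) (S So : Set (ι → Λ)) : Prop :=
  (∀ C : Computation A, C.state 0 ∈ S → C.Fair → ∃ T, C.state T ∈ So) ∧
  (∀ C : Computation A, C.state 0 ∈ S → ∀ T, C.state T ∈ So →
    ∀ t, T ≤ t → C.state t ∈ So ∧ C.state t = C.state T)

/-! ### Lattices of global states and lattice-linearity -/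

/-- `s ≺ s'` for global states: the componentwise order of the total orders `lt i` on the local
states of the nodes. -/
def GlobalLT {ι Λ : Type} (lt : ι → Λ → Λ → Prop) (s s' : ι → Λ) : Prop :=
  (∀ i, s i = s' i ∨ lt i (s i) (s' i)) ∧ ∃ i, lt i (s i) (s' i)

/-- `s ⪯ s'` for global states. -/
def GlobalLE {ι Λ : Type} (lt : ι → Λ → Λ → Prop) (s s' : ι → Λ) : Prop :=
  s = s' ∨ GlobalLT lt s s'

/-- Node `i` is impedensable in `s` for the predicate `P`, with respect to the order induced on the
set `S` of global states: `P` fails in `s`, and it fails in all later states in which the local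
state of `i` is unchanged. -/
def Impedensable {ι Λ : Type} (S : Set (ι → Λ)) (lt : ι → Λ → Λ → Prop) (P : (ι → Λ) → Prop)
    (i : ι) (s : ι → Λ) : Prop :=
  ¬ P s ∧ ∀ s' ∈ S, GlobalLT lt s s' → s' i = s i → ¬ P s'

/-- `A` is a self-stabilizing lattice-linear algorithm, under asynchrony, with the predicate `P`,
for the problem with state space `S` that is solved in the states satisfying `Solved`.  The states
of `S` split into disjoint parts `part k`, each with a total order `lt k i` on the local states of
each node `i`. -/
def IsSelfStabilizingLLA {ι Λ : Type} (A : Algorithm ι Λ) (S : Set (ι → Λ))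
    (Solved P : (ι → Λ) → Prop) : Prop :=
  -- the problem is solved exactly where `P` is true
  (∀ s ∈ S, Solved s ↔ P s) ∧
  ∃ (K : Type) (part : K → Set (ι → Λ)) (lt : K → ι → Λ → Λ → Prop),
    Nonempty K ∧
    (∀ k i, IsStrictTotalOrder Λ (lt k i)) ∧
    -- the parts are pairwise disjoint and their union is the state space
    (∀ k l, k ≠ l → Disjoint (part k) (part l)) ∧
    (⋃ k, part k) = S ∧
    -- `A` induces the order of `part k`: its computations stay in the part and go upwards
    (∀ k, ∀ C : Computation A, C.state 0 ∈ part k →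
      ∀ t, C.state t ∈ part k ∧ GlobalLE (lt k) (C.state t) (C.state (t + 1))) ∧
    -- `P` is lattice-linear in each part
    (∀ k, ∀ s ∈ part k, ¬ P s → ∃ i, Impedensable (part k) (lt k) P i s) ∧
    -- the nodes with a true guard are impedensable
    (∀ k, ∀ s ∈ part k, ∀ i, Enabled A i s → Impedensable (part k) (lt k) P i s) ∧
    -- each part has a supremum, and `P` is true there
    (∀ k, ∃ z ∈ part k, (∀ s ∈ part k, GlobalLE (lt k) s z) ∧ P z)

end LatticeLinear

/-! ### Myopic robots on the infinite triangular grid -/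

namespace GMRIT

/-- Vertices of the infinite triangular grid, in lattice coordinates: `(u, v)` is the point
`u • (√3/2, 1/2) + v • (-√3/2, 1/2)` of the plane, the second coordinate of the plane being the
agreed `y`-axis. -/
abbrev Vertex := ℤ × ℤ

/-- The six neighbouring locations: `v1` below, `v2l`, `v2r` lower left and right, `v3l`, `v3r`
upper left and right, `v4` above. -/
inductive Dir
  | v1 | v2l | v2r | v3l | v3r | v4

/-- The unit vector towards a neighbouring location, in lattice coordinates. -/
def Dir.vec : Dir → ℤ × ℤ
  | .v1 => (-1, -1)
  | .v2l => (-1, 0)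
  | .v2r => (0, -1)
  | .v3l => (0, 1)
  | .v3r => (1, 0)
  | .v4 => (1, 1)

/-- Reflection in the `y`-axis. -/
def Dir.mirror : Dir → Dir
  | .v1 => .v1
  | .v2l => .v2r
  | .v2r => .v2l
  | .v3l => .v3r
  | .v3r => .v3l
  | .v4 => .v4

theorem Dir.exists_vec_eq_neg (d : Dir) : ∃ e : Dir, e.vec = -d.vec := by
  cases d
  · exact ⟨.v4, by simp [Dir.vec]⟩
  · exact ⟨.v3r, by simp [Dir.vec]⟩
  · exact ⟨.v3l, by simp [Dir.vec]⟩
  · exact ⟨.v2r, by simp [Dir.vec]⟩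
  · exact ⟨.v2l, by simp [Dir.vec]⟩
  · exact ⟨.v1, by simp [Dir.vec]⟩

/-- The infinite triangular grid. -/
def grid : SimpleGraph Vertex where
  Adj p q := ∃ d : Dir, q = p + d.vec
  symm := ⟨by
    rintro p q ⟨d, rfl⟩
    obtain ⟨e, he⟩ := d.exists_vec_eq_neg
    exact ⟨e, by simp [he]⟩⟩
  loopless := ⟨by
    rintro p ⟨d, hd⟩
    have h : d.vec = 0 := by simpa using hd
    cases d <;> simp [Dir.vec] at h⟩

/-- A global state of `n` robots: the location of each robot. -/
abbrev State (n : ℕ) := Fin n → Vertex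

/-- The state space: the states whose visibility graph (the subgraph of the grid induced by the
occupied vertices) is connected. -/
def connectedStates (n : ℕ) : Set (State n) :=
  {s | (grid.induce (Set.range s)).Connected}

/-- All robots are at one vertex. -/
def Gathered {n : ℕ} (s : State n) : Prop :=
  ∃ p, ∀ i, s i = p

/-- What a robot senses: the set of neighbouring locations where a robot is present. -/
abbrev View := Set Dir

def viewOf {n : ℕ} (s : State n) (i : Fin n) : View :=
  {d | ∃ j, s j = s i + d.vec}

/-- The algorithm in which every robot applies `R`, which returns the direction of the move that
it makes, if any, to what it senses; robots are anonymous and oblivious of their coordinates. -/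
def robotAlgorithm (n : ℕ) (R : View → Option Dir) : LatticeLinear.Algorithm (Fin n) Vertex :=
  fun i s => (R (viewOf s i)).map fun d => s i + d.vec

/-- `R` does not use a distinction of left and right: the robots agree only on the `y`-axis. -/
def OneAxis (R : View → Option Dir) : Prop :=
  ∀ V : View, R (Dir.mirror '' V) = (R V).map Dir.mirror

/-- There is a robot at each location in `L`. -/
def At (V : View) (L : Set Dir) : Prop :=
  ∀ d ∈ L, d ∈ V

/-- There is a robot at each location in `L`, and at no other neighbouring location. -/
def OnlyAt (V : View) (L : Set Dir) : Prop :=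
  At V L ∧ ∀ d ∉ L, d ∉ V

/-- There is a robot below and none at the three upper locations, or there are robots exactly at
the two lower left and right locations. -/
def DownwardII (V : View) : Prop :=
  (At V {Dir.v1} ∧ ¬ At V {Dir.v3l} ∧ ¬ At V {Dir.v4} ∧ ¬ At V {Dir.v3r}) ∨
    OnlyAt V {Dir.v2l, Dir.v2r}

def DownslantLeftII (V : View) : Prop :=
  OnlyAt V {Dir.v2l}

def DownslantRightII (V : View) : Prop :=
  OnlyAt V {Dir.v2r}

open Classical in
/-- The rules of the revised algorithm; the three guards exclude one another. -/
noncomputable def revisedRule (V : View) : Option Dir :=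
  if DownwardII V then some Dir.v1
  else if DownslantRightII V then some Dir.v2r
  else if DownslantLeftII V then some Dir.v2l
  else none

/-- The revised algorithm for `n` robots. -/
noncomputable def revisedAlgorithm (n : ℕ) : LatticeLinear.Algorithm (Fin n) Vertex :=
  robotAlgorithm n revisedRule

/-- The lines of the grid with negative slope; they are further left for smaller `c`. -/
def negSlant (c : ℤ) : Set Vertex := {p | p.1 = c}

/-- The lines of the grid with positive slope; they are further right for smaller `c`. -/
def posSlant (c : ℤ) : Set Vertex := {p | p.2 = c}

/-- `negSlant c` is the leftmost negative slant that passes through a robot. -/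
def IsBottomL2RSlant {n : ℕ} (s : State n) (c : ℤ) : Prop :=
  (∃ i, s i ∈ negSlant c) ∧ ∀ c' < c, ∀ i, s i ∉ negSlant c'

/-- `posSlant c` is the rightmost positive slant that passes through a robot. -/
def IsBottomR2LSlant {n : ℕ} (s : State n) (c : ℤ) : Prop :=
  (∃ i, s i ∈ posSlant c) ∧ ∀ c' < c, ∀ i, s i ∉ posSlant c'

/-- `q` is the point `Q` of `s`: the intersection of its bottom `l2r` and bottom `r2l` slants. -/
def IsPointQ {n : ℕ} (s : State n) (q : Vertex) : Prop :=
  ∃ c d, IsBottomL2RSlant s c ∧ IsBottomR2LSlant s d ∧ negSlant c ∩ posSlant d = {q}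

end GMRIT

/-!
In lattice coordinates every move lowers a robot, and the point `Q` is the componentwise minimum of
the locations of the robots.  A robot moves only towards occupied vertices, or straight down between
two of them, so none moves past a slant through `Q`, and the robots on such a slant slide along it:
`Q` is the same at all times (`IsCorner.le_add_vec`, `isCorner_state`).  The part of the state space
with a given `Q` is ordered by height, its greatest element has all robots at `Q`, and the
impedensable robots are those that are not at `Q`.

The heart of the matter is that the visibility graph stays connected although robots act on old
snapshots.  A move is *pending* for a robot if some snapshot taken since its last move demands it.
Two robots share a *bond* (`Bond`) if they are at one vertex without pending moves to opposite sides,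
or if one is a lower neighbour of the other, has no pending move, and no pending move of the upper one
leads to the other side.  A robot whose guard holds has no upper neighbours; hence a lower neighbour
without pending move gets none as long as the upper robot stays.  It follows that bonds are never
broken, neither by new snapshots (`Bonded.refresh`) nor by moves (`Bonded.move`).  At the start,
neighbouring robots are bonded, so bonds connect all robots forever (`bonded_state`).

In a connected state that is not gathered, a topmost robot has a lower neighbour and no upper one, so
its guard holds (`IsCorner.exists_fires`).  Therefore each round lowers the greatest height by at
least one until all robots are at `Q` (`height_le_of_isRound`).  Since a connected state of `n` robots
spans fewer than `n` steps in each of the two coordinates, `2 * n` rounds are enough.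
-/

namespace GMRIT

variable {n : ℕ}

/-! ### The rule -/

theorem At_singleton (V : View) (d : Dir) : At V {d} ↔ d ∈ V := by
  simp [At]

theorem OnlyAt_iff (V : View) (L : Set Dir) : OnlyAt V L ↔ V = L :=
  ⟨fun h => Set.Subset.antisymm (fun d hd => by_contra fun hL => h.2 d hL hd) h.1,
    fun h => h ▸ ⟨fun _ hd => hd, fun _ hd => hd⟩⟩

theorem Dir.mirror_mirror (d : Dir) : d.mirror.mirror = d := by cases d <;> rfl

theorem mirror_image_eq_iff (V L : Set Dir) :
    Dir.mirror '' V = L ↔ V = Dir.mirror '' L := by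
  have h : ∀ W : Set Dir, Dir.mirror '' (Dir.mirror '' W) = W := fun W => by
    simp [Set.image_image, Dir.mirror_mirror]
  exact ⟨fun e => by rw [← e, h], fun e => by rw [e, h]⟩

theorem mem_mirror_image (V : Set Dir) (d : Dir) : d ∈ Dir.mirror '' V ↔ d.mirror ∈ V :=
  ⟨by rintro ⟨e, he, rfl⟩; rwa [Dir.mirror_mirror],
    fun h => ⟨_, h, d.mirror_mirror⟩⟩

theorem revisedRule_oneAxis : OneAxis revisedRule := by
  intro V
  have hD : DownwardII (Dir.mirror '' V) ↔ DownwardII V := by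
    simp only [DownwardII, At_singleton, OnlyAt_iff, mem_mirror_image, mirror_image_eq_iff,
      Set.image_pair, Dir.mirror, Set.pair_comm Dir.v2r Dir.v2l]
    tauto
  have hL : DownslantLeftII (Dir.mirror '' V) ↔ DownslantRightII V := by
    simp only [DownslantLeftII, DownslantRightII, OnlyAt_iff, mirror_image_eq_iff,
      Set.image_singleton, Dir.mirror]
  have hR : DownslantRightII (Dir.mirror '' V) ↔ DownslantLeftII V := by
    simp only [DownslantLeftII, DownslantRightII, OnlyAt_iff, mirror_image_eq_iff,
      Set.image_singleton, Dir.mirror]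
  have hLR : DownslantLeftII V → ¬ DownslantRightII V := by
    simp only [DownslantLeftII, DownslantRightII, OnlyAt_iff]
    rintro rfl h
    simp at h
  unfold revisedRule
  split_ifs <;> simp_all [Dir.mirror]

/-- What a move says about the view: nothing is above, and what is below supports the move. -/
theorem revisedRule_eq_some {V : View} {d : Dir} (h : revisedRule V = some d) :
    (Dir.v3l ∉ V ∧ Dir.v3r ∉ V ∧ Dir.v4 ∉ V) ∧
      (d = .v1 ∧ (Dir.v1 ∈ V ∨ Dir.v2l ∈ V ∧ Dir.v2r ∈ V) ∨
        d = .v2l ∧ Dir.v1 ∉ V ∧ Dir.v2l ∈ V ∧ Dir.v2r ∉ V ∨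
        d = .v2r ∧ Dir.v1 ∉ V ∧ Dir.v2l ∉ V ∧ Dir.v2r ∈ V) := by
  unfold revisedRule at h
  split_ifs at h with h1 h2 h3
  · simp only [DownwardII, At_singleton, OnlyAt_iff] at h1
    obtain rfl : Dir.v1 = d := by simpa using h
    rcases h1 with h1 | rfl
    · tauto
    · simp
  · obtain rfl : Dir.v2r = d := by simpa using h
    rw [DownslantRightII, OnlyAt_iff] at h2
    simp [h2]
  · obtain rfl : Dir.v2l = d := by simpa using h
    rw [DownslantLeftII, OnlyAt_iff] at h3
    simp [h3]

theorem revisedRule_ne_none {V : View} (hu : Dir.v3l ∉ V ∧ Dir.v3r ∉ V ∧ Dir.v4 ∉ V)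
    (hd : Dir.v1 ∈ V ∨ Dir.v2l ∈ V ∨ Dir.v2r ∈ V) : revisedRule V ≠ none := by
  unfold revisedRule
  split_ifs with h1 h2 h3 <;> try simp
  simp only [DownwardII, DownslantRightII, DownslantLeftII, At_singleton, OnlyAt_iff] at h1 h2 h3
  have key : ∀ L : Set Dir, (∀ d, d ∈ V ↔ d ∈ L) → V = L := fun L => Set.ext
  by_cases a : Dir.v1 ∈ V
  · tauto
  by_cases b : Dir.v2l ∈ V <;> by_cases c : Dir.v2r ∈ V
  · exact h1 (.inr (key _ (by rintro ⟨⟩ <;> simp_all)))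
  · exact h3 (key _ (by rintro ⟨⟩ <;> simp_all))
  · exact h2 (key _ (by rintro ⟨⟩ <;> simp_all))
  · tauto

/-! ### Connectedness -/

/-- Two robots are at the same vertex or at adjacent vertices. -/
def Near (s : State n) (i j : Fin n) : Prop :=
  s i = s j ∨ grid.Adj (s i) (s j)

theorem mem_connectedStates_iff (hn : 0 < n) (s : State n) :
    s ∈ connectedStates n ↔ ∀ i j, Relation.ReflTransGen (Near s) i j := by
  constructor
  · intro h
    have key : ∀ a b : Set.range s, (grid.induce (Set.range s)).Reachable a b →
        ∀ i j, s i = a → s j = b → Relation.ReflTransGen (Near s) i j := by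
      rintro a b ⟨w⟩
      induction w with
      | nil => exact fun i j hi hj => .single (.inl (hi.trans hj.symm))
      | @cons a c b hac _ ih =>
        intro i j hi hj
        obtain ⟨m, hm⟩ := c.2
        refine .head (.inr ?_) (ih m j hm hj)
        rw [hi, hm]
        exact hac
    exact fun i j => key ⟨s i, i, rfl⟩ ⟨s j, j, rfl⟩ (h.preconnected _ _) i j rfl rfl
  · intro h
    have key : ∀ i j, Relation.ReflTransGen (Near s) i j →
        (grid.induce (Set.range s)).Reachable ⟨s i, i, rfl⟩ ⟨s j, j, rfl⟩ := by
      intro i j hij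
      induction hij with
      | refl => exact .rfl
      | @tail b c _ hbc ih =>
        refine ih.trans ?_
        rcases hbc with hbc | hbc
        · have : (⟨s b, b, rfl⟩ : Set.range s) = ⟨s c, c, rfl⟩ := Subtype.ext hbc
          rw [this]
        · exact SimpleGraph.Adj.reachable (G := grid.induce (Set.range s)) hbc
    have : Nonempty (Set.range s) := ⟨⟨s ⟨0, hn⟩, _, rfl⟩⟩
    refine ⟨?_⟩
    rintro ⟨_, i, rfl⟩ ⟨_, j, rfl⟩
    exact key i j (h i j)

/-- A connected state that is not gathered leaves no robot without a neighbour. -/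
theorem exists_mem_viewOf {s : State n} (h : ∀ i j, Relation.ReflTransGen (Near s) i j)
    {i j : Fin n} (hij : s j ≠ s i) : ∃ d, d ∈ viewOf s i := by
  by_contra hno
  refine hij ?_
  have hr := h i j
  induction hr with
  | refl => rfl
  | @tail b c _ hbc ih =>
    by_cases hb : s b = s i
    · rcases hbc with hbc | ⟨d, hd⟩
      · exact hbc ▸ hb
      · exact absurd ⟨d, c, by rw [hd, hb]⟩ hno
    · exact absurd (ih hb) hb

/-! ### Bonds between robots -/

/-- The rule makes robot `i` move in the direction `d` if it looks at the state `s`. -/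
def Fires (s : State n) (i : Fin n) (d : Dir) : Prop :=
  revisedRule (viewOf s i) = some d

/-- Robot `i` hangs on robot `j`: robot `j` is a lower neighbour of `i` and has
no pending move, and no pending move of `i` leads away from `j`.  Here `M i d` says that robot `i` may make the move `d` next. -/
def Hangs (s : State n) (M : Fin n → Dir → Prop) (i j : Fin n) : Prop :=
  (∀ d, ¬ M j d) ∧
    (s j = s i + Dir.vec .v1 ∨ (s j = s i + Dir.vec .v2l ∧ ¬ M i .v2r) ∨
      (s j = s i + Dir.vec .v2r ∧ ¬ M i .v2l))

/-- The relation between robots that pending moves cannot break: the robots are at one vertex, and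
their pending moves do not lead them to opposite sides, or one of them hangs on the other.  A lower
neighbour that has a pending move is deliberately left out: it may move out of reach. -/
def Bond (s : State n) (M : Fin n → Dir → Prop) (i j : Fin n) : Prop :=
  (s i = s j ∧ ¬ (M i .v2l ∧ M j .v2r) ∧ ¬ (M i .v2r ∧ M j .v2l)) ∨ Hangs s M i j ∨ Hangs s M j i

/-- The invariant of asynchronous computations, for a state `s` and pending moves `M`: bonds connect
all robots, and a pending move to one side has a robot without pending move at its target. -/
structure Bonded (s : State n) (M : Fin n → Dir → Prop) : Prop where
  low : ∀ i d, M i d → d = .v1 ∨ d = .v2l ∨ d = .v2r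
  left : ∀ i, M i .v2l → ∃ j, (∀ d, ¬ M j d) ∧ s j = s i + Dir.vec .v2l
  right : ∀ i, M i .v2r → ∃ j, (∀ d, ¬ M j d) ∧ s j = s i + Dir.vec .v2r
  connected : ∀ i j, Relation.ReflTransGen (Bond s M) i j

theorem Bond.symm {s : State n} {M : Fin n → Dir → Prop} {i j : Fin n} (h : Bond s M i j) :
    Bond s M j i := by
  rcases h with ⟨h, h1, h2⟩ | h | h
  · exact .inl ⟨h.symm, fun h => h2 ⟨h.2, h.1⟩, fun h => h1 ⟨h.2, h.1⟩⟩
  · exact .inr (.inr h)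
  · exact .inr (.inl h)

theorem Hangs.near {s : State n} {M : Fin n → Dir → Prop} {i j : Fin n} (h : Hangs s M i j) :
    grid.Adj (s i) (s j) := by
  rcases h.2 with h | ⟨h, _⟩ | ⟨h, _⟩ <;> exact ⟨_, h⟩

theorem Bond.near {s : State n} {M : Fin n → Dir → Prop} {i j : Fin n} (h : Bond s M i j) :
    Near s i j := by
  rcases h with h | h | h
  · exact .inl h.1
  · exact .inr h.near
  · exact .inr h.near.symm

theorem Near.bond {s : State n} {i j : Fin n} (h : Near s i j) :
    Bond s (fun _ _ => False) i j := by
  rcases h with h | ⟨d, hd⟩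
  · exact .inl ⟨h, by simp, by simp⟩
  · refine .inr ?_
    simp only [Hangs, Prod.ext_iff] at hd ⊢
    cases d <;> simp [Dir.vec] at hd ⊢ <;> omega

/-- A robot with an upper neighbour has no true guard. -/
theorem not_fires_of_lower {s : State n} {i j : Fin n} {e : Dir}
    (he : e = .v1 ∨ e = .v2l ∨ e = .v2r) (h : s j = s i + e.vec) (d : Dir) : ¬ Fires s j d := by
  intro hf
  obtain ⟨⟨h3, h4, h5⟩, _⟩ := revisedRule_eq_some hf
  rcases he with rfl | rfl | rfl
  · exact h5 ⟨i, by rw [h]; simp [Dir.vec, Prod.ext_iff]⟩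
  · exact h4 ⟨i, by rw [h]; simp [Dir.vec, Prod.ext_iff]⟩
  · exact h3 ⟨i, by rw [h]; simp [Dir.vec, Prod.ext_iff]⟩

/-- Robots at one vertex sense the same. -/
theorem viewOf_congr {s : State n} {i j : Fin n} (h : s i = s j) : viewOf s i = viewOf s j := by
  simp [viewOf, h]

/-- If a guard of `i` holds, then some robot without pending move is at a lower neighbour of `i`: as
nothing is above, only bonds that go down tie the robots at the vertex of `i` to the others. -/
theorem Bonded.exists_support {s : State n} {M : Fin n → Dir → Prop} (h : Bonded s M) {i : Fin n}
    {d : Dir} (hf : Fires s i d) :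
    ∃ j, (∀ d, ¬ M j d) ∧ (s j = s i + Dir.vec .v1 ∨ s j = s i + Dir.vec .v2l ∨
      s j = s i + Dir.vec .v2r) := by
  obtain ⟨⟨h3, h4, h5⟩, hd⟩ := revisedRule_eq_some hf
  obtain ⟨k, hk⟩ : ∃ k, s k ≠ s i := by
    have : ∀ e : Dir, e ∈ viewOf s i → ∃ k, s k ≠ s i := by
      rintro e ⟨k, hk⟩
      refine ⟨k, fun hk' => ?_⟩
      rw [hk'] at hk
      cases e <;> simp [Dir.vec, Prod.ext_iff] at hk
    rcases hd with ⟨_, h | h⟩ | h | h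
    · exact this _ h
    · exact this _ h.1
    · exact this _ h.2.2.1
    · exact this _ h.2.2.2
  by_contra hno
  refine hk ?_
  have hr := h.connected i k
  clear hk
  induction hr with
  | refl => rfl
  | @tail b c _ hbc ih =>
    rcases hbc with hbc | hbc | hbc
    · rw [← hbc.1, ih]
    · refine absurd ⟨c, hbc.1, ?_⟩ hno
      rw [← ih]
      have := hbc.2
      tauto
    · exfalso
      rcases hbc.2 with h | ⟨h, _⟩ | ⟨h, _⟩
      · exact h5 ⟨c, by rw [← ih, h]; simp [Dir.vec, Prod.ext_iff]⟩
      · exact h4 ⟨c, by rw [← ih, h]; simp [Dir.vec, Prod.ext_iff]⟩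
      · exact h3 ⟨c, by rw [← ih, h]; simp [Dir.vec, Prod.ext_iff]⟩

/-- New snapshots break no bond.  No robot with an upper neighbour acquires a pending move, since all
guards require that there is none; and a robot with a pending move to one
side keeps a motionless neighbour on that side, which rules out that a robot at the same vertex
finds reason to move to the other side. -/
theorem Bonded.refresh {s : State n} {M M' : Fin n → Dir → Prop} (h : Bonded s M)
    (hM : ∀ i d, M' i d ↔ M i d ∨ Fires s i d) : Bonded s M' := by
  have idle : ∀ i j, (∀ d, ¬ M j d) → (s j = s i + Dir.vec .v1 ∨ s j = s i + Dir.vec .v2l ∨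
      s j = s i + Dir.vec .v2r) → ∀ d, ¬ M' j d := by
    intro i j hj hij d hd
    rcases (hM j d).1 hd with hd | hd
    · exact hj d hd
    · rcases hij with hij | hij | hij
      · exact not_fires_of_lower (.inl rfl) hij d hd
      · exact not_fires_of_lower (.inr (.inl rfl)) hij d hd
      · exact not_fires_of_lower (.inr (.inr rfl)) hij d hd
  have fl : ∀ i, Fires s i .v2l → Dir.v1 ∉ viewOf s i ∧ Dir.v2r ∉ viewOf s i := by
    intro i hi
    have := (revisedRule_eq_some hi).2
    simp at this
    tauto
  have fr : ∀ i, Fires s i .v2r → Dir.v1 ∉ viewOf s i ∧ Dir.v2l ∉ viewOf s i := by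
    intro i hi
    have := (revisedRule_eq_some hi).2
    simp at this
    tauto
  -- A robot with a pending move to one side keeps a robot on that side in the view.
  have not_fr : ∀ i, M i .v2l → ¬ Fires s i .v2r := by
    intro i hi hf
    obtain ⟨j, _, hj⟩ := h.left i hi
    exact (fr i hf).2 ⟨j, hj⟩
  have not_fl : ∀ i, M i .v2r → ¬ Fires s i .v2l := by
    intro i hi hf
    obtain ⟨j, _, hj⟩ := h.right i hi
    exact (fl i hf).2 ⟨j, hj⟩
  have hang : ∀ i j, Hangs s M i j → Hangs s M' i j := by
    rintro i j ⟨h1, h2⟩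
    refine ⟨idle i j h1 (by tauto), ?_⟩
    rcases h2 with h2 | ⟨h2, h3⟩ | ⟨h2, h3⟩
    · exact .inl h2
    · refine .inr (.inl ⟨h2, fun hm => ?_⟩)
      rcases (hM _ _).1 hm with hm | hm
      · exact h3 hm
      · exact (fr i hm).2 ⟨j, h2⟩
    · refine .inr (.inr ⟨h2, fun hm => ?_⟩)
      rcases (hM _ _).1 hm with hm | hm
      · exact h3 hm
      · exact (fl i hm).2 ⟨j, h2⟩
  refine ⟨?_, ?_, ?_, fun i j => Relation.ReflTransGen.mono ?_ _ _ (h.connected i j)⟩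
  · intro i d hd
    rcases (hM i d).1 hd with hd | hd
    · exact h.low i d hd
    · have := (revisedRule_eq_some hd).2
      tauto
  · intro i hi
    rcases (hM i _).1 hi with hi | hi
    · obtain ⟨j, hj, hs⟩ := h.left i hi
      exact ⟨j, idle i j hj (by tauto), hs⟩
    · obtain ⟨j, hj, hs⟩ := h.exists_support hi
      refine ⟨j, idle i j hj hs, ?_⟩
      rcases hs with hs | hs | hs
      · exact absurd ⟨j, hs⟩ (fl i hi).1
      · exact hs
      · exact absurd ⟨j, hs⟩ (fl i hi).2
  · intro i hi
    rcases (hM i _).1 hi with hi | hi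
    · obtain ⟨j, hj, hs⟩ := h.right i hi
      exact ⟨j, idle i j hj (by tauto), hs⟩
    · obtain ⟨j, hj, hs⟩ := h.exists_support hi
      refine ⟨j, idle i j hj hs, ?_⟩
      rcases hs with hs | hs | hs
      · exact absurd ⟨j, hs⟩ (fr i hi).1
      · exact absurd ⟨j, hs⟩ (fr i hi).2
      · exact hs
  · rintro i j (⟨hs, h1, h2⟩ | hij | hij)
    · have e : ∀ d, Fires s i d ↔ Fires s j d := fun d => by rw [Fires, Fires, viewOf_congr hs]
      have one : ¬ (Fires s i .v2l ∧ Fires s i .v2r) := fun ⟨a, b⟩ => by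
        simpa using a.symm.trans b
      refine .inl ⟨hs, ?_, ?_⟩ <;> simp only [hM]
      · rintro ⟨a | a, b | b⟩
        · exact h1 ⟨a, b⟩
        · exact not_fr i a ((e _).2 b)
        · exact not_fl j b ((e _).1 a)
        · exact one ⟨a, (e _).2 b⟩
      · rintro ⟨a | a, b | b⟩
        · exact h2 ⟨a, b⟩
        · exact not_fl i a ((e _).2 b)
        · exact not_fr j b ((e _).1 a)
        · exact one ⟨(e _).2 b, a⟩
    · exact .inr (.inl (hang i j hij))
    · exact .inr (.inr (hang j i hij))

/-- Pending moves, carried out by any set of robots at the same time, break no bond: `M'` consists of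
the pending moves of the robots that have stayed where they were. -/
theorem Bonded.move {s s' : State n} {M M' : Fin n → Dir → Prop} (h : Bonded s M)
    (hs : ∀ i, s' i = s i ∨ ∃ d, M i d ∧ s' i = s i + d.vec)
    (hM : ∀ i d, M' i d ↔ M i d ∧ s' i = s i) : Bonded s' M' := by
  have stay : ∀ j, (∀ d, ¬ M j d) → s' j = s j := fun j hj =>
    (hs j).resolve_right fun ⟨d, hd, _⟩ => hj d hd
  have idle : ∀ j, (∀ d, ¬ M j d) → ∀ d, ¬ M' j d := fun j hj d hd => hj d ((hM j d).1 hd).1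
  have moved : ∀ i, s' i ≠ s i → ∀ d, ¬ M' i d := fun i hi d hd => hi ((hM i d).1 hd).2
  -- The three ways to move, with the pending move that they use.
  have ways : ∀ i, (s' i = s i) ∨ (M i .v1 ∧ s' i = s i + Dir.vec .v1) ∨
      (M i .v2l ∧ s' i = s i + Dir.vec .v2l) ∨ (M i .v2r ∧ s' i = s i + Dir.vec .v2r) := by
    intro i
    rcases hs i with hi | ⟨d, hd, hi⟩
    · exact .inl hi
    · rcases h.low i d hd with rfl | rfl | rfl <;> tauto
  have moved_of : ∀ i, ((M i .v1 ∧ s' i = s i + Dir.vec .v1) ∨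
      (M i .v2l ∧ s' i = s i + Dir.vec .v2l) ∨ (M i .v2r ∧ s' i = s i + Dir.vec .v2r)) →
      ∀ d, ¬ M' i d := by
    intro i hi
    apply moved
    rcases hi with ⟨-, hi⟩ | ⟨-, hi⟩ | ⟨-, hi⟩ <;> rw [hi] <;> simp [Dir.vec, Prod.ext_iff]
  have sub : ∀ i d, M' i d → M i d := fun i d hd => ((hM i d).1 hd).1
  have together : ∀ i j, s i = s j → ¬ (M i .v2l ∧ M j .v2r) → ¬ (M i .v2r ∧ M j .v2l) →
      ((M i .v1 ∧ s' i = s i + Dir.vec .v1) ∨ (M i .v2l ∧ s' i = s i + Dir.vec .v2l) ∨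
        (M i .v2r ∧ s' i = s i + Dir.vec .v2r)) → Bond s' M' i j := by
    intro i j e h1 h2 hi
    have hi' := moved_of i hi
    have a3 := sub j .v2l
    have a4 := sub j .v2r
    rcases ways j with hj | hj
    · rw [← e] at hj
      refine .inr (.inr ⟨hi', ?_⟩)
      rw [hj]
      tauto
    · have hj' := moved_of j hj
      rw [← e] at hj
      simp only [Bond, Hangs, hi', hj']
      simp only [Prod.ext_iff, Dir.vec, Prod.fst_add, Prod.snd_add] at hi hj ⊢
      simp only [not_false_eq_true, and_true, false_and, implies_true, true_and]
      rcases hi with ⟨mi, hi⟩ | ⟨mi, hi⟩ | ⟨mi, hi⟩ <;>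
        rcases hj with ⟨mj, hj⟩ | ⟨mj, hj⟩ | ⟨mj, hj⟩ <;>
        first | omega | exact (h1 ⟨mi, mj⟩).elim | exact (h2 ⟨mi, mj⟩).elim
  have hang : ∀ i j, Hangs s M i j → Bond s' M' i j := by
    rintro i j ⟨h1, h2⟩
    have hj := stay j h1
    have hj' := idle j h1
    rcases ways i with hi | hi
    · refine .inr (.inl ⟨hj', ?_⟩)
      rw [hi, hj]
      have h3 : ∀ d, ¬ M i d → ¬ M' i d := fun d hd hd' => hd ((hM i d).1 hd').1
      have := h3 .v2l
      have := h3 .v2r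
      tauto
    · have hi' := moved_of i hi
      simp only [Bond, Hangs, hi', hj', hj]
      simp only [Prod.ext_iff, Dir.vec, Prod.fst_add, Prod.snd_add] at hi h2 ⊢
      simp only [not_false_eq_true, and_true, false_and, implies_true, true_and]
      rcases hi with ⟨hm, hi⟩ | ⟨hm, hi⟩ | ⟨hm, hi⟩ <;>
        rcases h2 with h2 | ⟨h2, h3⟩ | ⟨h2, h3⟩ <;> first | omega | exact absurd hm h3
  refine ⟨?_, ?_, ?_, fun i j => Relation.ReflTransGen.mono ?_ _ _ (h.connected i j)⟩
  · exact fun i d hd => h.low i d ((hM i d).1 hd).1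
  · intro i hi
    obtain ⟨hi, e⟩ := (hM i _).1 hi
    obtain ⟨j, hj, hij⟩ := h.left i hi
    exact ⟨j, idle j hj, by rw [stay j hj, e, hij]⟩
  · intro i hi
    obtain ⟨hi, e⟩ := (hM i _).1 hi
    obtain ⟨j, hj, hij⟩ := h.right i hi
    exact ⟨j, idle j hj, by rw [stay j hj, e, hij]⟩
  · rintro i j (⟨e, h1, h2⟩ | hij | hij)
    · rcases ways i with hi | hi
      · rcases ways j with hj | hj
        · exact .inl ⟨by rw [hi, hj, e], fun h => h1 ⟨sub _ _ h.1, sub _ _ h.2⟩,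
            fun h => h2 ⟨sub _ _ h.1, sub _ _ h.2⟩⟩
        · exact (together j i e.symm (fun h => h2 ⟨h.2, h.1⟩) (fun h => h1 ⟨h.2, h.1⟩) hj).symm
      · exact together i j e h1 h2 hi
    · exact hang i j hij
    · exact (hang j i hij).symm

/-! ### The corner point -/

/-- `q` is the componentwise minimum of the locations of the robots, that is, the point `Q`.  The order
`≤` on `Vertex` is the componentwise one. -/
structure IsCorner (s : State n) (q : Vertex) : Prop where
  le : ∀ i, q ≤ s i
  fst : ∃ i, (s i).1 = q.1
  snd : ∃ i, (s i).2 = q.2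

theorem exists_isCorner (hn : 0 < n) (s : State n) : ∃ q, IsCorner s q := by
  have : Nonempty (Fin n) := ⟨⟨0, hn⟩⟩
  obtain ⟨i, hi⟩ := Finite.exists_min fun i => (s i).1
  obtain ⟨j, hj⟩ := Finite.exists_min fun i => (s i).2
  exact ⟨((s i).1, (s j).2), fun k => ⟨hi k, hj k⟩, ⟨i, rfl⟩, ⟨j, rfl⟩⟩

theorem IsCorner.eq {s : State n} {q q' : Vertex} (h : IsCorner s q) (h' : IsCorner s q') :
    q = q' := by
  obtain ⟨i, hi⟩ := h.fst
  obtain ⟨j, hj⟩ := h.snd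
  obtain ⟨i', hi'⟩ := h'.fst
  obtain ⟨j', hj'⟩ := h'.snd
  exact Prod.ext (le_antisymm (hi' ▸ (h.le i').1) (hi ▸ (h'.le i).1))
    (le_antisymm (hj' ▸ (h.le j').2) (hj ▸ (h'.le j).2))

theorem isPointQ_iff_isCorner {s : State n} {q : Vertex} : IsPointQ s q ↔ IsCorner s q := by
  constructor
  · rintro ⟨c, d, ⟨⟨i, hi⟩, hc⟩, ⟨⟨j, hj⟩, hd⟩, h⟩
    obtain ⟨rfl, rfl⟩ : q.1 = c ∧ q.2 = d := by
      have : q ∈ negSlant c ∩ posSlant d := h ▸ rfl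
      exact this
    exact ⟨fun k => ⟨not_lt.1 fun hk => hc _ hk k rfl, not_lt.1 fun hk => hd _ hk k rfl⟩,
      ⟨i, hi⟩, ⟨j, hj⟩⟩
  · intro h
    refine ⟨q.1, q.2, ⟨h.fst, fun c hc i hi => ?_⟩, ⟨h.snd, fun c hc i hi => ?_⟩, ?_⟩
    · exact absurd (h.le i).1 (not_le.2 (by rw [show (s i).1 = c from hi]; exact hc))
    · exact absurd (h.le i).2 (not_le.2 (by rw [show (s i).2 = c from hi]; exact hc))
    · ext p
      simp [negSlant, posSlant, Prod.ext_iff]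

theorem IsCorner.gathered_iff {s : State n} {q : Vertex} (h : IsCorner s q) :
    Gathered s ↔ ∀ i, s i = q := by
  refine ⟨?_, fun h => ⟨q, h⟩⟩
  rintro ⟨p, hp⟩ k
  obtain ⟨i, hi⟩ := h.fst
  obtain ⟨j, hj⟩ := h.snd
  rw [hp] at hi hj ⊢
  exact Prod.ext hi hj

/-- A robot never moves past the corner, since it only moves beside or towards other robots. -/
theorem IsCorner.le_add_vec {s : State n} {q : Vertex} (h : IsCorner s q) {i : Fin n} {d : Dir}
    (hf : Fires s i d) : q ≤ s i + d.vec := by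
  have key : ∀ e, e ∈ viewOf s i → q ≤ s i + e.vec := by
    rintro e ⟨j, hj⟩
    exact hj ▸ h.le j
  rcases (revisedRule_eq_some hf).2 with ⟨rfl, hd | ⟨hl, hr⟩⟩ | ⟨rfl, -, hd, -⟩ | ⟨rfl, -, -, hd⟩
  · exact key _ hd
  · exact ⟨(key _ hl).1, (key _ hr).2⟩
  · exact key _ hd
  · exact key _ hd

theorem Fires.add_vec_le {s : State n} {i : Fin n} {d : Dir} (hf : Fires s i d) (p : Vertex) :
    p + d.vec ≤ p ∧ (p + d.vec).1 + (p + d.vec).2 < p.1 + p.2 := by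
  rcases (revisedRule_eq_some hf).2 with ⟨rfl, -⟩ | ⟨rfl, -⟩ | ⟨rfl, -⟩ <;>
    simp only [Prod.le_def, Dir.vec, Prod.fst_add, Prod.snd_add] <;> omega

/-- The corner persists: a robot on one of the two slants through `q` can only slide along it. -/
theorem IsCorner.of_le {s s' : State n} {q : Vertex} (h : IsCorner s q) (h1 : ∀ i, q ≤ s' i)
    (h2 : ∀ i, s' i ≤ s i) : IsCorner s' q := by
  refine ⟨h1, ?_, ?_⟩
  · obtain ⟨i, hi⟩ := h.fst
    exact ⟨i, le_antisymm (hi ▸ (h2 i).1) (h1 i).1⟩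
  · obtain ⟨i, hi⟩ := h.snd
    exact ⟨i, le_antisymm (hi ▸ (h2 i).2) (h1 i).2⟩

theorem IsCorner.not_fires {s : State n} {q : Vertex} (h : IsCorner s q) {i : Fin n}
    (hi : s i = q) (d : Dir) : ¬ Fires s i d := by
  intro hf
  have h1 := h.le_add_vec hf
  have h2 := (hf.add_vec_le (s i)).2
  rw [hi] at h1 h2
  have := h1.1
  have := h1.2
  omega

/-- A robot of greatest height that is not at the corner moves. -/
theorem IsCorner.exists_fires {s : State n} {q : Vertex} (h : IsCorner s q)
    (hc : ∀ i j, Relation.ReflTransGen (Near s) i j) {i : Fin n} (hi : s i ≠ q)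
    (htop : ∀ j, (s j).1 + (s j).2 ≤ (s i).1 + (s i).2) : ∃ d, Fires s i d := by
  obtain ⟨j, hj⟩ : ∃ j, s j ≠ s i := by
    by_contra! hall
    exact hi (h.gathered_iff.1 ⟨s i, hall⟩ i)
  have up : ∀ e : Dir, 0 < e.vec.1 + e.vec.2 → e ∉ viewOf s i := by
    rintro e he ⟨k, hk⟩
    have := htop k
    rw [hk, Prod.fst_add, Prod.snd_add] at this
    omega
  have h3 := up .v3l (by decide)
  have h4 := up .v3r (by decide)
  have h5 := up .v4 (by decide)
  obtain ⟨e, he⟩ := exists_mem_viewOf hc hj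
  refine Option.ne_none_iff_exists'.1 (revisedRule_ne_none ⟨h3, h4, h5⟩ ?_)
  cases e <;> tauto

/-- In a connected state, the values at the robots of a function that grows by at most `1` along each
edge leave no gap. -/
theorem exists_eq_of_connected {s : State n} (hc : ∀ i j, Relation.ReflTransGen (Near s) i j)
    (f : Vertex → ℤ) (hf : ∀ p q, grid.Adj p q → f q ≤ f p + 1) (i j : Fin n) {k : ℤ}
    (hi : f (s i) ≤ k) (hj : k ≤ f (s j)) : ∃ m, f (s m) = k := by
  have hr := hc i j
  induction hr with
  | refl => exact ⟨i, le_antisymm hi hj⟩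
  | @tail b c _ hbc ih =>
    by_cases hb : k ≤ f (s b)
    · exact ih hb
    · refine ⟨c, ?_⟩
      rcases hbc with hbc | hbc
      · rw [hbc] at hb
        exact absurd hj hb
      · have := hf _ _ hbc
        omega

theorem sub_lt_card_of_connected {s : State n} (hc : ∀ i j, Relation.ReflTransGen (Near s) i j)
    (f : Vertex → ℤ) (hf : ∀ p q, grid.Adj p q → f q ≤ f p + 1) (i j : Fin n) :
    f (s j) - f (s i) < n := by
  have hsub : Finset.Icc (f (s i)) (f (s j)) ⊆ Finset.univ.image fun m => f (s m) := by
    intro k hk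
    obtain ⟨m, hm⟩ := exists_eq_of_connected hc f hf i j (Finset.mem_Icc.1 hk).1
      (Finset.mem_Icc.1 hk).2
    exact Finset.mem_image.2 ⟨m, Finset.mem_univ _, hm⟩
  have h1 := (Finset.card_le_card hsub).trans Finset.card_image_le
  rw [Int.card_Icc, Finset.card_univ, Fintype.card_fin] at h1
  omega

theorem IsCorner.height_le {s : State n} {q : Vertex} (h : IsCorner s q)
    (hc : ∀ i j, Relation.ReflTransGen (Near s) i j) (i : Fin n) :
    (s i).1 + (s i).2 ≤ q.1 + q.2 + 2 * n := by
  obtain ⟨a, ha⟩ := h.fst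
  obtain ⟨b, hb⟩ := h.snd
  have h1 := sub_lt_card_of_connected hc Prod.fst
    (by rintro p _ ⟨d, rfl⟩; cases d <;> simp [Dir.vec]) a i
  have h2 := sub_lt_card_of_connected hc Prod.snd
    (by rintro p _ ⟨d, rfl⟩; cases d <;> simp [Dir.vec]) b i
  omega

/-! ### Asynchronous computations -/

theorem revisedAlgorithm_apply (i : Fin n) (s : State n) :
    revisedAlgorithm n i s = (revisedRule (viewOf s i)).map fun d => s i + d.vec :=
  rfl

/-- Robot `i` may make the move `d` at time `t`: its guards demanded that move in a snapshot that
it could have taken since it arrived where it is. -/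
def Pending (C : LatticeLinear.Computation (revisedAlgorithm n)) (t : ℕ) (i : Fin n) (d : Dir) :
    Prop :=
  ∃ τ ≤ t, (∀ r, τ ≤ r → r ≤ t → C.state r i = C.state t i) ∧ Fires (C.state τ) i d

section Computation

variable (C : LatticeLinear.Computation (revisedAlgorithm n))

theorem state_succ_of_fires {t : ℕ} {i : Fin n} {d : Dir} (hi : i ∈ C.active t)
    (hf : Fires (C.state (C.look t i)) i d) : C.state (t + 1) i = C.state t i + d.vec := by
  rw [C.step_active t i hi, revisedAlgorithm_apply, show revisedRule _ = _ from hf,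
    ← C.not_moved t i hi _ le_rfl (C.look_le t i hi)]
  rfl

theorem state_succ (t : ℕ) (i : Fin n) :
    C.state (t + 1) i = C.state t i ∨ ∃ d, Pending C t i d ∧
      C.state (t + 1) i = C.state t i + d.vec := by
  by_cases hi : i ∈ C.active t
  · cases hr : revisedRule (viewOf (C.state (C.look t i)) i) with
    | none =>
      left
      rw [C.step_active t i hi, revisedAlgorithm_apply, hr]
      rfl
    | some d =>
      exact .inr ⟨d, ⟨_, C.look_le t i hi, C.not_moved t i hi, hr⟩, state_succ_of_fires C hi hr⟩
  · exact .inl (C.step_idle t i hi)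

theorem pending_zero (i : Fin n) (d : Dir) : Pending C 0 i d ↔ Fires (C.state 0) i d := by
  constructor
  · rintro ⟨τ, hτ, -, hf⟩
    obtain rfl : τ = 0 := by omega
    exact hf
  · intro hf
    refine ⟨0, le_rfl, fun r _ hr => ?_, hf⟩
    obtain rfl : r = 0 := by omega
    rfl

theorem pending_succ (t : ℕ) (i : Fin n) (d : Dir) :
    Pending C (t + 1) i d ↔
      (Pending C t i d ∧ C.state (t + 1) i = C.state t i) ∨ Fires (C.state (t + 1)) i d := by
  constructor
  · rintro ⟨τ, hτ, hr, hf⟩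
    rcases Nat.lt_or_ge t τ with h | h
    · obtain rfl : τ = t + 1 := by omega
      exact .inr hf
    · have e := hr t h (by omega)
      exact .inl ⟨⟨τ, h, fun r h1 h2 => (hr r h1 (by omega)).trans e.symm, hf⟩, e.symm⟩
  · rintro (⟨⟨τ, hτ, hr, hf⟩, e⟩ | hf)
    · refine ⟨τ, by omega, fun r h1 h2 => ?_, hf⟩
      rcases Nat.lt_or_ge t r with h | h
      · obtain rfl : r = t + 1 := by omega
        rfl
      · rw [e, hr r h1 h]
    · refine ⟨t + 1, le_rfl, fun r h1 h2 => ?_, hf⟩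
      obtain rfl : r = t + 1 := by omega
      rfl

theorem bonded_state (hn : 0 < n) (h0 : C.state 0 ∈ connectedStates n) (t : ℕ) :
    Bonded (C.state t) (Pending C t) := by
  induction t with
  | zero =>
    refine Bonded.refresh (M := fun _ _ => False) ⟨by simp, by simp, by simp, fun i j => ?_⟩
      fun i d => by rw [pending_zero, false_or]
    exact Relation.ReflTransGen.mono (fun _ _ => Near.bond) _ _
      ((mem_connectedStates_iff hn _).1 h0 i j)
  | succ t ih => exact (ih.move (state_succ C t) fun _ _ => Iff.rfl).refresh (pending_succ C t)

theorem near_state (hn : 0 < n) (h0 : C.state 0 ∈ connectedStates n) (t : ℕ) (i j : Fin n) :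
    Relation.ReflTransGen (Near (C.state t)) i j :=
  Relation.ReflTransGen.mono (fun _ _ => Bond.near) _ _ ((bonded_state C hn h0 t).connected i j)

theorem state_succ_le (t : ℕ) (i : Fin n) : C.state (t + 1) i ≤ C.state t i := by
  rcases state_succ C t i with h | ⟨d, ⟨τ, _, _, hf⟩, h⟩
  · exact h.le
  · exact h ▸ (hf.add_vec_le _).1

theorem state_anti (i : Fin n) : Antitone fun t => C.state t i :=
  antitone_nat_of_succ_le fun t => state_succ_le C t i

theorem height_anti (i : Fin n) {t t' : ℕ} (h : t ≤ t') :
    (C.state t' i).1 + (C.state t' i).2 ≤ (C.state t i).1 + (C.state t i).2 :=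
  add_le_add (state_anti C i h).1 (state_anti C i h).2

/-- The corner is the same at all times.  The induction is strong because the move at time `t` may rest
on a snapshot of any earlier state. -/
theorem isCorner_state {q : Vertex} (h0 : IsCorner (C.state 0) q) (t : ℕ) :
    IsCorner (C.state t) q := by
  induction t using Nat.strong_induction_on with
  | _ t ih =>
    cases t with
    | zero => exact h0
    | succ t =>
      have ht := ih t (by omega)
      refine ht.of_le (fun i => ?_) (state_succ_le C t)
      rcases state_succ C t i with h | ⟨d, ⟨τ, hτ, hr, hf⟩, h⟩
      · exact h ▸ ht.le i
      · rw [h, ← hr τ le_rfl hτ]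
        exact (ih τ (by omega)).le_add_vec hf

theorem state_eq_of_eq_corner {q : Vertex} (h0 : IsCorner (C.state 0) q) {t t' : ℕ} (h : t ≤ t')
    {i : Fin n} (hi : C.state t i = q) : C.state t' i = q :=
  le_antisymm (hi ▸ state_anti C i h) ((isCorner_state C h0 t').le i)

/-- Every round lowers the greatest height, as long as it exceeds that of the corner: a robot that
is still at that height when it takes its snapshot in the round is a topmost robot then. -/
theorem height_le_of_isRound (hn : 0 < n) (hc : C.state 0 ∈ connectedStates n) {q : Vertex}
    (h0 : IsCorner (C.state 0) q) {a b : ℕ} (hab : C.IsRound a b) {L : ℤ} (hL : q.1 + q.2 < L)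
    (ha : ∀ i, (C.state a i).1 + (C.state a i).2 ≤ L) (i : Fin n) :
    (C.state b i).1 + (C.state b i).2 ≤ L - 1 := by
  obtain ⟨t, hat, htb, hi, hl⟩ := hab i
  have hlt := C.look_le t i hi
  have hq : ∀ j, (C.state (C.look t i) j).1 + (C.state (C.look t i) j).2 ≤ L := fun j =>
    (height_anti C j hl).trans (ha j)
  rcases (hq i).lt_or_eq with h | h
  · have := height_anti C i (show C.look t i ≤ b by omega)
    omega
  · obtain ⟨d, hd⟩ := (isCorner_state C h0 (C.look t i)).exists_fires
      (near_state C hn hc _) (i := i) (by rintro e; rw [e] at h; omega) (fun j => h ▸ hq j)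
    have h1 := (hd.add_vec_le (C.state t i)).2
    rw [← state_succ_of_fires C hi hd] at h1
    have h2 := height_anti C i htb
    have h3 := height_anti C i hlt
    simp only [Nat.succ_eq_add_one] at h2
    omega

theorem gathered_of_rounds (hn : 0 < n) (hc : C.state 0 ∈ connectedStates n) {q : Vertex}
    (h0 : IsCorner (C.state 0) q) (r : ℕ → ℕ) (hr0 : r 0 = 0)
    (hr : ∀ k, k < 2 * n → C.IsRound (r k) (r (k + 1))) (t : ℕ) (ht : r (2 * n) ≤ t) (i : Fin n) :
    C.state t i = q := by
  have key : ∀ k, k ≤ 2 * n → ∀ i, (C.state (r k) i).1 + (C.state (r k) i).2 ≤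
      q.1 + q.2 + 2 * n - k := by
    intro k
    induction k with
    | zero =>
      intro _ i
      have := h0.height_le ((mem_connectedStates_iff hn _).1 hc) i
      rw [hr0]
      push_cast
      omega
    | succ k ih =>
      intro hk i
      have := height_le_of_isRound C hn hc h0 (hr k hk) (L := q.1 + q.2 + 2 * n - k) (by omega)
        (ih (by omega)) i
      push_cast
      omega
  refine state_eq_of_eq_corner C h0 ht ?_
  have h1 := key _ le_rfl i
  have h2 := (isCorner_state C h0 (r (2 * n))).le i
  push_cast at h1
  exact Prod.ext (by have := h2.1; have := h2.2; omega) (by have := h2.1; have := h2.2; omega)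

theorem exists_isRound (hf : C.Fair) (a : ℕ) : ∃ b, C.IsRound a b := by
  choose t ht hl using fun i => hf i a
  refine ⟨Finset.univ.sup t + 1, fun i => ⟨t i, ?_, ?_, ht i, hl i⟩⟩
  · exact (hl i).trans (C.look_le _ _ (ht i))
  · exact Nat.lt_succ_of_le (Finset.le_sup (f := t) (Finset.mem_univ i))

theorem eventually_gathered (hn : 0 < n) (hc : C.state 0 ∈ connectedStates n) {q : Vertex}
    (h0 : IsCorner (C.state 0) q) (hf : C.Fair) : ∃ T, ∀ t, T ≤ t → ∀ i, C.state t i = q := by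
  choose next hnext using exists_isRound C hf
  let r : ℕ → ℕ := fun k => next^[k] 0
  refine ⟨r (2 * n), gathered_of_rounds C hn hc h0 r rfl fun k _ => ?_⟩
  simp only [r, Function.iterate_succ_apply']
  exact hnext _

end Computation

/-! ### The lattice of global states -/

theorem enabled_iff {s : State n} {i : Fin n} :
    LatticeLinear.Enabled (revisedAlgorithm n) i s ↔ ∃ d, Fires s i d := by
  rw [LatticeLinear.Enabled, revisedAlgorithm_apply, ne_eq, Option.map_eq_none_iff,
    ← ne_eq, Option.ne_none_iff_exists']
  rfl

theorem IsCorner.gathered_iff_not_enabled (hn : 0 < n) {s : State n} {q : Vertex}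
    (h : IsCorner s q) (hs : s ∈ connectedStates n) :
    Gathered s ↔ ∀ i, ¬ LatticeLinear.Enabled (revisedAlgorithm n) i s := by
  constructor
  · intro hg i hi
    obtain ⟨d, hd⟩ := enabled_iff.1 hi
    exact h.not_fires (h.gathered_iff.1 hg i) d hd
  · intro hno
    have : Nonempty (Fin n) := ⟨⟨0, hn⟩⟩
    obtain ⟨i, hi⟩ := Finite.exists_max fun i => (s i).1 + (s i).2
    have hiq : s i = q := by
      by_contra hiq
      exact hno i (enabled_iff.2 (h.exists_fires ((mem_connectedStates_iff hn s).1 hs) hiq hi))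
    refine h.gathered_iff.2 fun j => ?_
    have h1 := hi j
    have h2 := h.le j
    rw [hiq] at h1
    have := h2.1
    have := h2.2
    exact Prod.ext (by omega) (by omega)

/-- The order on the locations of a robot: lower vertices come later, and among vertices of the
same height those further left. -/
def Later (p p' : Vertex) : Prop :=
  p'.1 + p'.2 < p.1 + p.2 ∨ p'.1 + p'.2 = p.1 + p.2 ∧ p'.1 < p.1

theorem later_isStrictTotalOrder : IsStrictTotalOrder Vertex Later where
  trichotomous p p' h h' := by
    simp only [Later] at h h'
    exact Prod.ext (by omega) (by omega)
  irrefl p h := by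
    simp only [Later] at h
    omega
  trans p p' p'' h h' := by
    simp only [Later] at h h' ⊢
    omega

theorem later_of_lt {p q : Vertex} (h : q ≤ p) (hne : p ≠ q) : Later p q := by
  have h1 := h.1
  have h2 := h.2
  simp only [Later, ne_eq, Prod.ext_iff] at hne ⊢
  omega

theorem globalLE_of_le {s s' : State n} (h : ∀ i, s' i ≤ s i) :
    LatticeLinear.GlobalLE (fun _ => Later) s s' := by
  by_cases e : s = s'
  · exact .inl e
  · obtain ⟨i, hi⟩ := Function.ne_iff.1 e
    refine .inr ⟨fun j => ?_, i, later_of_lt (h i) hi⟩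
    by_cases hj : s j = s' j
    · exact .inl hj
    · exact .inr (later_of_lt (h j) hj)

/-- The part of the state space with corner `q`. -/
def part (n : ℕ) (q : Vertex) : Set (State n) :=
  {s | s ∈ connectedStates n ∧ IsCorner s q}

/-- Every robot that is not at the corner is impedensable. -/
theorem impedensable_of_ne (hn : 0 < n) {q : Vertex} {s : State n} (hs : s ∈ part n q) {i : Fin n}
    (hi : s i ≠ q) :
    LatticeLinear.Impedensable (part n q) (fun _ => Later)
      (fun s => ∀ i, ¬ LatticeLinear.Enabled (revisedAlgorithm n) i s) i s := by
  have key : ∀ s' ∈ part n q, s' i = s i →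
      ¬ ∀ i, ¬ LatticeLinear.Enabled (revisedAlgorithm n) i s' := by
    intro s' hs' e hP
    have := hs'.2.gathered_iff.1 ((hs'.2.gathered_iff_not_enabled hn hs'.1).2 hP) i
    exact hi (e ▸ this)
  exact ⟨key s hs rfl, fun s' hs' _ e => key s' hs' e⟩

theorem revisedAlgorithm_isSelfStabilizingLLA (hn : 0 < n) :
    LatticeLinear.IsSelfStabilizingLLA (revisedAlgorithm n) (connectedStates n)
      Gathered (fun s => ∀ i, ¬ LatticeLinear.Enabled (revisedAlgorithm n) i s) := by
  refine ⟨fun s hs => ?_, Vertex, part n, fun _ _ => Later, ⟨0⟩,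
    fun _ _ => later_isStrictTotalOrder, ?_, ?_, ?_, ?_, ?_, ?_⟩
  · obtain ⟨q, hq⟩ := exists_isCorner hn s
    exact hq.gathered_iff_not_enabled hn hs
  · intro k l hkl
    exact Set.disjoint_left.2 fun s hk hl => hkl (hk.2.eq hl.2)
  · ext s
    refine ⟨fun h => ?_, fun h => ?_⟩
    · obtain ⟨q, hq⟩ := Set.mem_iUnion.1 h
      exact hq.1
    · obtain ⟨q, hq⟩ := exists_isCorner hn s
      exact Set.mem_iUnion.2 ⟨q, h, hq⟩
  · rintro q C ⟨hc, h0⟩ t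
    exact ⟨⟨(mem_connectedStates_iff hn _).2 (near_state C hn hc t), isCorner_state C h0 t⟩,
      globalLE_of_le (state_succ_le C t)⟩
  · intro q s hs hP
    have hg : ¬ ∀ i, s i = q := fun hg =>
      hP ((hs.2.gathered_iff_not_enabled hn hs.1).1 ⟨q, hg⟩)
    obtain ⟨i, hi⟩ := not_forall.1 hg
    exact ⟨i, impedensable_of_ne hn hs hi⟩
  · intro q s hs i hi
    obtain ⟨d, hd⟩ := enabled_iff.1 hi
    exact impedensable_of_ne hn hs fun e => hs.2.not_fires e d hd
  · intro q
    have hcon : (fun _ => q) ∈ connectedStates n :=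
      (mem_connectedStates_iff hn _).2 fun _ _ => .single (.inl rfl)
    have hq : IsCorner (fun _ : Fin n => q) q := ⟨fun _ => le_rfl, ⟨⟨0, hn⟩, rfl⟩, ⟨⟨0, hn⟩, rfl⟩⟩
    exact ⟨fun _ => q, ⟨hcon, hq⟩, fun s hs => globalLE_of_le hs.2.le,
      (hq.gathered_iff_not_enabled hn hcon).1 ⟨q, fun _ => rfl⟩⟩

theorem revisedAlgorithm_isSilentSelfStabilizing (hn : 0 < n) :
    LatticeLinear.IsSilentSelfStabilizing (revisedAlgorithm n) (connectedStates n)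
      {s | Gathered s} := by
  constructor
  · intro C hc hf
    obtain ⟨q, hq⟩ := exists_isCorner hn (C.state 0)
    obtain ⟨T, hT⟩ := eventually_gathered C hn hc hq hf
    exact ⟨T, q, hT T le_rfl⟩
  · intro C hc T hT t ht
    obtain ⟨q, hq⟩ := exists_isCorner hn (C.state 0)
    have h1 := (isCorner_state C hq T).gathered_iff.1 hT
    have h2 : ∀ i, C.state t i = q := fun i => state_eq_of_eq_corner C hq ht (h1 i)
    exact ⟨⟨q, h2⟩, funext fun i => (h2 i).trans (h1 i).symm⟩

end GMRIT

theorem mainTheorem5 (n : ℕ) (hn : 0 < n) :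
    GMRIT.OneAxis GMRIT.revisedRule ∧
    LatticeLinear.IsSelfStabilizingLLA (GMRIT.revisedAlgorithm n) (GMRIT.connectedStates n)
      GMRIT.Gathered (fun s => ∀ i, ¬ LatticeLinear.Enabled (GMRIT.revisedAlgorithm n) i s) ∧
    LatticeLinear.IsSilentSelfStabilizing (GMRIT.revisedAlgorithm n) (GMRIT.connectedStates n)
      {s | GMRIT.Gathered s} ∧
    ∀ C : LatticeLinear.Computation (GMRIT.revisedAlgorithm n),
      C.state 0 ∈ GMRIT.connectedStates n →
      ∃ q : GMRIT.Vertex,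
        (∀ q', GMRIT.IsPointQ (C.state 0) q' ↔ q' = q) ∧
        (C.Fair → ∃ T, ∀ t, T ≤ t → ∀ i, C.state t i = q) ∧
        (∀ r : ℕ → ℕ, r 0 = 0 → (∀ k, k < 2 * n → C.IsRound (r k) (r (k + 1))) →
          ∀ t, r (2 * n) ≤ t → ∀ i, C.state t i = q) := by
  refine ⟨GMRIT.revisedRule_oneAxis, GMRIT.revisedAlgorithm_isSelfStabilizingLLA hn,
    GMRIT.revisedAlgorithm_isSilentSelfStabilizing hn, fun C hc => ?_⟩
  obtain ⟨q, hq⟩ := GMRIT.exists_isCorner hn (C.state 0)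
  refine ⟨q, fun q' => ?_, GMRIT.eventually_gathered C hn hc hq,
    GMRIT.gathered_of_rounds C hn hc hq⟩
  rw [GMRIT.isPointQ_iff_isCorner]
  exact ⟨fun h => h.eq hq, fun h => h ▸ hq⟩
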